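/- A pebble distribution on a finite simple graph $G$ is a function $P\colon V(G)\to\mathbb{Z}_{\ge 0}$; its size is $\sum_{v\in V(G)}P(v)$. A pebbling move removes two pebbles from a vertex that has at least two pebbles and adds one pebble to an adjacent vertex. The distribution $P$ is solvable if for every vertex $v$ there is a (possibly empty) sequence of pebbling moves, starting from $P$, after which $v$ has at least one pebble. The optimal pebbling number $\pi_{\mathrm{opt}}(G)$ is the minimum size of a solvable distribution on $G$. Let $P_k$ denote the path on $k$ vertices and $\square$ the Cartesian product of graphs. Then for all integers $n,m\ge 5$, $$\pi_{\mathrm{opt}}(P_n\,\square\,P_m)\;\ge\;\frac{2}{13}\,nm .$$ -/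

import Mathlib

namespace Pebbling

/-- A pebble distribution on a vertex set `V`: the number of pebbles at each vertex. -/
abbrev Distribution (V : Type*) := V → ℕ

/-- The size of a distribution: the total number of pebbles. -/
def Distribution.size {V : Type*} [Fintype V] (P : Distribution V) : ℕ := ∑ v, P v

/-- `IsMove G P Q`: a single pebbling move turns `P` into `Q`, i.e. there are adjacent vertices
`u`, `v` with at least two pebbles on `u` such that `Q` arises from `P` by removing two pebbles
from `u` and adding one pebble to `v`. -/
def IsMove {V : Type*} (G : SimpleGraph V) (P Q : Distribution V) : Prop :=
  ∃ u v : V, G.Adj u v ∧ P u = Q u + 2 ∧ Q v = P v + 1 ∧ ∀ w, w ≠ u → w ≠ v → Q w = P w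

/-- `Q` is obtained from `P` by a (possibly empty) executable sequence of pebbling moves. -/
def Obtainable {V : Type*} (G : SimpleGraph V) : Distribution V → Distribution V → Prop :=
  Relation.ReflTransGen (IsMove G)

/-- The vertex `v` is `k`-reachable under `P`. -/
def IsKReachable {V : Type*} (G : SimpleGraph V) (P : Distribution V) (k : ℕ) (v : V) : Prop :=
  ∃ Q : Distribution V, Obtainable G P Q ∧ k ≤ Q v

/-- A distribution is solvable if every vertex is reachable (that is, `1`-reachable). -/
def IsSolvable {V : Type*} (G : SimpleGraph V) (P : Distribution V) : Prop :=
  ∀ v : V, IsKReachable G P 1 v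

/-- The optimal pebbling number: the least size of a solvable distribution. -/
noncomputable def optimalPebblingNumber {V : Type*} [Fintype V] (G : SimpleGraph V) : ℕ :=
  sInf {k : ℕ | ∃ P : Distribution V, IsSolvable G P ∧ P.size = k}

/-- The minimum in the definition of the optimal pebbling number is attained. -/
theorem isLeast_optimalPebblingNumber {V : Type*} [Fintype V] (G : SimpleGraph V) :
    IsLeast {k : ℕ | ∃ P : Distribution V, IsSolvable G P ∧ P.size = k}
      (optimalPebblingNumber G) := by
  have hne : {k : ℕ | ∃ P : Distribution V, IsSolvable G P ∧ P.size = k}.Nonempty :=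
    ⟨_, fun _ => 1, fun _ => ⟨_, Relation.ReflTransGen.refl, le_rfl⟩, rfl⟩
  exact ⟨Nat.sInf_mem hne, fun _ hk => Nat.sInf_le hk⟩

end Pebbling

/-! Let `T` be the set of 2-reachable vertices. A pebble at `u` is worth `2 ^ (-d)` to `v ∈ T`,
where `d` is the distance inside `T`. Every move starts in `T`, so it cannot raise the total worth
to `v`, and that worth is at least 2 initially (`two_le_sum_distWeight`).

By solvability, a vertex outside the closed neighbourhood `X` of `T` carries its own pebble. Each `x
∈ X` is charged to a representative in `T`, itself or a neighbour. Double counting then reduces the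
theorem to showing that one pebble is worth at most 13 in total to the representatives.

The grid distance `D` gives `∑ 2 ^ (-D) ≤ 3 * 3 = 9`, but a vertex outside `T` may receive twice its
share from a representative nearer to `u`. `sum_distWeight_representatives_le` bounds this excess by
1 plus a correction for vertices with more than two outward neighbours. These lie on the axes
through `u` and cost at most 3. -/

namespace Pebbling

open Finset

/-! ### Distance weights inside a vertex set -/

section General

variable {V : Type*} (G : SimpleGraph V)

/-- The edges of `G` with both ends in `T`. -/
def edgesWithin (T : Set V) : SimpleGraph V where
  Adj a b := G.Adj a b ∧ a ∈ T ∧ b ∈ T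
  symm := ⟨fun _ _ h => ⟨h.1.symm, h.2.2, h.2.1⟩⟩
  loopless := ⟨fun _ h => G.loopless.irrefl _ h.1⟩

open Classical in
/-- The weight `2 ^ (-d)`, with `d` the distance of `u` and `v`; it vanishes if there is no path
between them. -/
noncomputable def distWeight (H : SimpleGraph V) (u v : V) : ℝ :=
  if H.Reachable u v then (1 / 2 : ℝ) ^ H.dist u v else 0

theorem distWeight_nonneg (H : SimpleGraph V) (u v : V) : 0 ≤ distWeight H u v := by
  unfold distWeight
  split_ifs <;> positivity

theorem distWeight_self (H : SimpleGraph V) (u : V) : distWeight H u u = 1 := by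
  simp [distWeight]

theorem distWeight_le_two_mul {H : SimpleGraph V} {a b : V} (h : H.Adj a b) (v : V) :
    distWeight H b v ≤ 2 * distWeight H a v := by
  unfold distWeight
  by_cases hb : H.Reachable b v
  · have ha : H.Reachable a v := h.reachable.trans hb
    rw [if_pos ha, if_pos hb]
    obtain ⟨p, hp⟩ := hb.exists_walk_length_eq_dist
    have hle : H.dist a v ≤ H.dist b v + 1 := by
      rw [← hp, ← SimpleGraph.Walk.length_cons h p]
      exact SimpleGraph.dist_le _
    have h2 : (1 / 2 : ℝ) ^ (H.dist b v + 1) ≤ (1 / 2 : ℝ) ^ H.dist a v :=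
      pow_le_pow_of_le_one (by norm_num) (by norm_num) hle
    rw [pow_succ] at h2
    linarith
  · rw [if_neg hb]
    split_ifs <;> positivity

theorem distWeight_edgesWithin_eq_zero {T : Set V} {u v : V} (hv : v ∈ T) (hu : u ∉ T) :
    distWeight (edgesWithin G T) u v = 0 := by
  unfold distWeight
  rw [if_neg]
  rintro ⟨p⟩
  cases p with
  | nil => exact hu hv
  | cons h _ => exact hu h.2.1

theorem distWeight_edgesWithin_eq_zero' {T : Set V} {u v : V} (hu : u ∈ T) (hv : v ∉ T) :
    distWeight (edgesWithin G T) u v = 0 := by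
  unfold distWeight
  rw [if_neg]
  intro h
  obtain ⟨p⟩ := h.symm
  cases p with
  | nil => exact hv hu
  | cons h _ => exact hv h.2.1

/-- A function that changes by at most one along edges bounds the distance from a zero of it. -/
theorem le_dist_of_forall_adj {H : SimpleGraph V} {D : V → ℕ}
    (hD : ∀ a b, H.Adj a b → D b ≤ D a + 1) {u v : V} (hu : D u = 0) (h : H.Reachable u v) :
    D v ≤ H.dist u v := by
  obtain ⟨p, hp⟩ := h.exists_walk_length_eq_dist
  rw [← hp]
  have key : ∀ {a b : V} (q : H.Walk a b), D b ≤ D a + q.length := by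
    intro a b q
    induction q with
    | nil => simp
    | cons h q ih =>
      have := hD _ _ h
      rw [SimpleGraph.Walk.length_cons]
      omega
  have := key p
  omega

/-- Distances are integers, so a weight that misses its upper bound loses at least a factor of two.
This offsets the factor gained by passing to a neighbouring representative. -/
theorem distWeight_eq_or_le {H : SimpleGraph V} {D : V → ℕ}
    (hD : ∀ a b, H.Adj a b → D b ≤ D a + 1) {u : V} (hu : D u = 0) (v : V) :
    distWeight H u v = (1 / 2 : ℝ) ^ D v ∨ distWeight H u v ≤ (1 / 2 : ℝ) ^ (D v + 1) := by
  unfold distWeight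
  by_cases h : H.Reachable u v
  · rw [if_pos h]
    rcases (le_dist_of_forall_adj hD hu h).eq_or_lt with h1 | h1
    · left; rw [h1]
    · right
      exact pow_le_pow_of_le_one (by norm_num) (by norm_num) h1
  · right
    rw [if_neg h]
    positivity

theorem distWeight_le {H : SimpleGraph V} {D : V → ℕ}
    (hD : ∀ a b, H.Adj a b → D b ≤ D a + 1) {u : V} (hu : D u = 0) (v : V) :
    distWeight H u v ≤ (1 / 2 : ℝ) ^ D v := by
  rcases distWeight_eq_or_le hD hu v with h | h
  · exact h.le
  · exact h.trans (pow_le_pow_of_le_one (by norm_num) (by norm_num) (Nat.le_succ _))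

/-- The penultimate vertex of a geodesic from `u` to `v` must attain its bound too, since `D` grows
by at most one per edge. -/
theorem exists_adj_of_distWeight_eq {H : SimpleGraph V} {D : V → ℕ}
    (hD : ∀ a b, H.Adj a b → D b ≤ D a + 1) {u v : V} (hu : D u = 0) (huv : v ≠ u)
    (h : distWeight H u v = (1 / 2 : ℝ) ^ D v) :
    ∃ w, H.Adj w v ∧ D v = D w + 1 ∧ distWeight H u w = (1 / 2 : ℝ) ^ D w := by
  have hr : H.Reachable u v := by
    by_contra hr
    rw [distWeight, if_neg hr] at h
    have : (0 : ℝ) < (1 / 2 : ℝ) ^ D v := by positivity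
    linarith
  have hd : H.dist u v = D v := by
    rw [distWeight, if_pos hr] at h
    exact pow_right_injective₀ (by norm_num : (0 : ℝ) < 1 / 2) (by norm_num) h
  obtain ⟨p, hp⟩ := hr.symm.exists_walk_length_eq_dist
  cases p with
  | nil => exact absurd rfl huv
  | @cons _ w _ hvw q =>
    rw [SimpleGraph.Walk.length_cons, SimpleGraph.dist_comm, hd] at hp
    have hw : H.Reachable u w := q.reverse.reachable
    have h1 : H.dist u w ≤ q.length := by
      rw [SimpleGraph.dist_comm]; exact SimpleGraph.dist_le q
    have h2 := le_dist_of_forall_adj hD hu hw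
    have h3 := hD _ _ hvw.symm
    refine ⟨w, hvw.symm, by omega, ?_⟩
    rw [distWeight, if_pos hw]
    congr 1
    omega

/-! ### Weight inequality for pebbling moves and double counting -/

variable {G}

theorem reachable_cases {P : Distribution V} {x : V} (h : IsKReachable G P 1 x) :
    1 ≤ P x ∨ ∃ v, IsKReachable G P 2 v ∧ G.Adj v x := by
  obtain ⟨Q, hQ, hx⟩ := h
  induction hQ with
  | refl => exact Or.inl hx
  | @tail Q Q' hPQ hmove ih =>
    obtain ⟨a, b, hab, ha, hb, hw⟩ := hmove
    by_cases hxb : x = b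
    · subst hxb
      exact Or.inr ⟨a, ⟨Q, hPQ, by omega⟩, hab⟩
    · apply ih
      by_cases hxa : x = a
      · subst hxa; omega
      · rw [← hw x hxa hxb]; exact hx

variable [Fintype V]

theorem sum_distWeight_le {P Q : Distribution V} (hQ : Obtainable G P Q) {v : V}
    (hv : IsKReachable G P 2 v) :
    ∑ u, (Q u : ℝ) * distWeight (edgesWithin G {v | IsKReachable G P 2 v}) u v ≤
      ∑ u, (P u : ℝ) * distWeight (edgesWithin G {v | IsKReachable G P 2 v}) u v := by
  classical
  induction hQ with
  | refl => exact le_rfl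
  | @tail Q Q' hPQ hmove ih =>
    refine le_trans ?_ ih
    obtain ⟨a, b, hab, ha, hb, hw⟩ := hmove
    set T : Set V := {v | IsKReachable G P 2 v} with hT
    set f : V → ℝ := fun u => distWeight (edgesWithin G T) u v with hf
    have haT : a ∈ T := ⟨Q, hPQ, by omega⟩
    -- The two pebbles removed from `a` pay for the one added at `b`; a pebble leaving `T` becomes
    -- worthless.
    have hle : f b ≤ 2 * f a := by
      by_cases hbT : b ∈ T
      · exact distWeight_le_two_mul (H := edgesWithin G T) ⟨hab, haT, hbT⟩ v
      · have : f b = 0 := distWeight_edgesWithin_eq_zero G hv hbT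
        have := distWeight_nonneg (edgesWithin G T) a v
        simp only [hf] at *
        linarith
    have hne : a ≠ b := hab.ne
    have hsum : ∀ R : Distribution V, ∑ u, (R u : ℝ) * f u =
        (R a : ℝ) * f a + ((R b : ℝ) * f b + ∑ u ∈ (univ.erase a).erase b, (R u : ℝ) * f u) := by
      intro R
      rw [← Finset.add_sum_erase univ _ (mem_univ a),
        ← Finset.add_sum_erase (univ.erase a) _ (mem_erase.2 ⟨hne.symm, mem_univ b⟩)]
    have hrest : ∑ u ∈ (univ.erase a).erase b, (Q' u : ℝ) * f u =
        ∑ u ∈ (univ.erase a).erase b, (Q u : ℝ) * f u := by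
      refine sum_congr rfl fun u hu => ?_
      simp only [mem_erase, mem_univ, and_true] at hu
      rw [hw u hu.2 hu.1]
    change ∑ u, (Q' u : ℝ) * f u ≤ ∑ u, (Q u : ℝ) * f u
    rw [hsum Q', hsum Q, hrest, ha, hb]
    push_cast
    linarith

theorem two_le_sum_distWeight {P : Distribution V} {v : V} (hv : IsKReachable G P 2 v) :
    2 ≤ ∑ u, (P u : ℝ) * distWeight (edgesWithin G {v | IsKReachable G P 2 v}) u v := by
  obtain ⟨Q, hQ, h2⟩ := id hv
  refine le_trans ?_ (sum_distWeight_le hQ hv)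
  refine le_trans ?_ (single_le_sum (fun u _ => mul_nonneg (Nat.cast_nonneg (Q u))
    (distWeight_nonneg _ u v)) (mem_univ v))
  rw [distWeight_self, mul_one]
  exact_mod_cast h2

/-- A bound on the size of the closed neighbourhood of the 2-reachable vertices, given for each of
them a bound on its total distance weight to representatives of the neighbourhood, bounds the
number of vertices by the size of a solvable distribution. -/
theorem two_mul_card_le_of_isSolvable {P : Distribution V} (hP : IsSolvable G P) {C : ℝ}
    (hC : 2 ≤ C)
    (h : ∀ (T : Set V) (X : Finset V) (ρ : V → V),
      (∀ x ∈ X, ρ x ∈ T ∧ (ρ x = x ∨ x ∉ T ∧ G.Adj (ρ x) x)) →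
      ∀ u ∈ T, ∑ x ∈ X, distWeight (edgesWithin G T) u (ρ x) ≤ C) :
    2 * (Fintype.card V : ℝ) ≤ C * (P.size : ℝ) := by
  classical
  set T : Set V := {v | IsKReachable G P 2 v} with hT
  set X : Finset V := univ.filter fun x => ∃ v ∈ T, v = x ∨ x ∉ T ∧ G.Adj v x with hX
  have hchoose : ∀ x, ∃ v, x ∈ X → v ∈ T ∧ (v = x ∨ x ∉ T ∧ G.Adj v x) := by
    intro x
    by_cases hx : x ∈ X
    · obtain ⟨v, hv, h1⟩ := (mem_filter.1 hx).2
      exact ⟨v, fun _ => ⟨hv, h1⟩⟩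
    · exact ⟨x, fun h => absurd h hx⟩
  choose ρ hρ using hchoose
  have hbound := h T X ρ hρ
  have hTX : ∀ x ∈ T, x ∈ X := fun x hx => mem_filter.2 ⟨mem_univ _, x, hx, Or.inl rfl⟩
  -- Only pebbles on `T ⊆ X` are charged, so those outside `X` remain available to pay for their own
  -- vertices.
  have hXcard : 2 * (X.card : ℝ) ≤ ∑ u, if u ∈ X then C * (P u : ℝ) else 0 := by
    calc 2 * (X.card : ℝ) = ∑ x ∈ X, (2 : ℝ) := by simp [mul_comm]
      _ ≤ ∑ x ∈ X, ∑ u, (P u : ℝ) * distWeight (edgesWithin G T) u (ρ x) :=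
        sum_le_sum fun x hx => two_le_sum_distWeight (hρ x hx).1
      _ = ∑ u, (P u : ℝ) * ∑ x ∈ X, distWeight (edgesWithin G T) u (ρ x) := by
        rw [sum_comm]; simp_rw [mul_sum]
      _ ≤ _ := by
        refine sum_le_sum fun u _ => ?_
        by_cases huT : u ∈ T
        · rw [if_pos (hTX u huT), mul_comm]
          exact mul_le_mul_of_nonneg_right (hbound u huT) (Nat.cast_nonneg _)
        · rw [sum_eq_zero fun x hx => distWeight_edgesWithin_eq_zero G (hρ x hx).1 huT, mul_zero]
          split_ifs <;> positivity
  have hrest : ∀ x, x ∉ X → 1 ≤ P x := by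
    intro x hx
    rcases reachable_cases (hP x) with h1 | ⟨v, hv, hadj⟩
    · exact h1
    · refine absurd (mem_filter.2 ⟨mem_univ _, v, hv, Or.inr ⟨?_, hadj⟩⟩) hx
      exact fun hxT => hx (hTX x hxT)
  have hcard : (Fintype.card V : ℝ) = X.card + ∑ u, if u ∈ X then (0 : ℝ) else 1 := by
    rw [← card_univ, ← nsmul_one, ← sum_const, ← sum_filter_add_sum_filter_not univ (· ∈ X),
      sum_ite]
    simp
  have hsize : (P.size : ℝ) = ∑ u, (P u : ℝ) := by simp [Distribution.size]
  rw [hcard, hsize, mul_add]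
  refine (add_le_add_left hXcard _).trans ?_
  rw [mul_sum, mul_sum, ← sum_add_distrib]
  refine sum_le_sum fun u _ => ?_
  by_cases hu : u ∈ X
  · simp [hu]
  · have : (1 : ℝ) ≤ P u := by exact_mod_cast hrest u hu
    simp only [hu, if_false]
    nlinarith

/-- The weights of representatives of a neighbourhood of `T` are at most the weights `2 ^ (-D)`,
with a correction term for the vertices that attain the bound. -/
theorem sum_distWeight_representatives_le {T : Set V} {X : Finset V} {ρ : V → V}
    (hρ : ∀ x ∈ X, ρ x ∈ T ∧ (ρ x = x ∨ x ∉ T ∧ G.Adj (ρ x) x))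
    {D : V → ℕ} (hD : ∀ a b, G.Adj a b → D b ≤ D a + 1) {u : V} (huT : u ∈ T) (hu : D u = 0)
    (t : V → ℝ) (ht0 : ∀ v, 0 ≤ t v)
    (ht : ∀ v, (Nat.card {x // G.Adj v x ∧ D x = D v + 1} : ℝ) ≤ 2 * (1 + t v)) :
    ∑ x ∈ X, distWeight (edgesWithin G T) u (ρ x) ≤
      1 + ∑ x, (1 / 2 : ℝ) ^ D x + ∑ x, t x * (1 / 2 : ℝ) ^ D x := by
  classical
  set H := edgesWithin G T with hH
  have hDH : ∀ a b, H.Adj a b → D b ≤ D a + 1 := fun a b h => hD a b h.1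
  -- `A` consists of the vertices joined to `u` within `T` by a path as short as `D` allows; `B`
  -- collects their outward neighbours.
  set A : Finset V := univ.filter fun v => distWeight H u v = (1 / 2 : ℝ) ^ D v with hA
  set out : V → Finset V := fun v => univ.filter fun x => G.Adj v x ∧ D x = D v + 1 with hout
  set B : Finset V := univ.filter fun x => ∃ v ∈ A, x ∈ out v with hB
  have hw : ∀ x, (0 : ℝ) ≤ (1 / 2 : ℝ) ^ D x := fun x => by positivity
  have hAT : ∀ x ∈ A, x ∈ T := by
    intro x hx
    by_contra hxT
    have h1 := (mem_filter.1 hx).2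
    rw [distWeight_edgesWithin_eq_zero' G huT hxT] at h1
    have : (0 : ℝ) < (1 / 2 : ℝ) ^ D x := by positivity
    linarith
  have huA : u ∈ A := mem_filter.2 ⟨mem_univ _, by rw [distWeight_self, hu, pow_zero]⟩
  have hAB : A.erase u ⊆ B := by
    intro x hx
    obtain ⟨hxu, hxA⟩ := mem_erase.1 hx
    obtain ⟨w, hwx, hDw, hww⟩ := exists_adj_of_distWeight_eq hDH hu hxu (mem_filter.1 hxA).2
    exact mem_filter.2 ⟨mem_univ _, w, mem_filter.2 ⟨mem_univ _, hww⟩,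
      mem_filter.2 ⟨mem_univ _, hwx.1, hDw⟩⟩
  -- Doubling requires `x ∉ T` and a representative in `A` that is one step nearer to `u`, hence `x
  -- ∈ B \ A`.
  have hval : ∀ x ∈ X, distWeight H u (ρ x) ≤
      (1 / 2 : ℝ) ^ D x + if x ∈ B \ A.erase u then (1 / 2 : ℝ) ^ D x else 0 := by
    intro x hx
    obtain ⟨hρT, h1 | ⟨hxT, hadj⟩⟩ := hρ x hx
    · rw [h1]
      have := distWeight_le hDH hu x
      have := hw x
      split_ifs <;> linarith
    · have hxA : x ∉ A := fun h => hxT (hAT x h)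
      have h2 : D x ≤ D (ρ x) + 1 := hD _ _ hadj
      have h3 : (1 / 2 : ℝ) ^ (D (ρ x) + 1) ≤ (1 / 2 : ℝ) ^ D x :=
        pow_le_pow_of_le_one (by norm_num) (by norm_num) h2
      by_cases hxB : x ∈ B
      · rw [if_pos (mem_sdiff.2 ⟨hxB, fun h => hxA (mem_of_mem_erase h)⟩)]
        have h4 := distWeight_le hDH hu (ρ x)
        rw [pow_succ] at h3
        linarith
      · rw [if_neg (fun h => hxB (mem_sdiff.1 h).1), add_zero]
        rcases distWeight_eq_or_le hDH hu (ρ x) with h4 | h4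
        · have h5 : D x ≤ D (ρ x) := by
            by_contra hlt
            exact hxB (mem_filter.2 ⟨mem_univ _, ρ x, mem_filter.2 ⟨mem_univ _, h4⟩,
              mem_filter.2 ⟨mem_univ _, hadj, by omega⟩⟩)
          rw [h4]
          exact pow_le_pow_of_le_one (by norm_num) (by norm_num) h5
        · exact h4.trans h3
  have hBsum : ∑ x ∈ B, (1 / 2 : ℝ) ^ D x ≤ ∑ v ∈ A, (1 + t v) * (1 / 2 : ℝ) ^ D v := by
    calc ∑ x ∈ B, (1 / 2 : ℝ) ^ D x
        ≤ ∑ x ∈ B, ∑ v ∈ A, if x ∈ out v then (1 / 2 : ℝ) ^ D x else 0 := by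
          refine sum_le_sum fun x hx => ?_
          obtain ⟨v, hv, hxv⟩ := (mem_filter.1 hx).2
          refine le_trans ?_ (single_le_sum (fun v _ => ?_) hv)
          · rw [if_pos hxv]
          · split_ifs
            · exact hw x
            · exact le_rfl
      _ ≤ ∑ x, ∑ v ∈ A, if x ∈ out v then (1 / 2 : ℝ) ^ D x else 0 := by
          refine sum_le_sum_of_subset_of_nonneg (subset_univ _) fun x _ _ =>
            sum_nonneg fun v _ => ?_
          split_ifs
          · exact hw x
          · exact le_rfl
      _ = ∑ v ∈ A, ∑ x ∈ out v, (1 / 2 : ℝ) ^ D x := by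
          rw [sum_comm]
          refine sum_congr rfl fun v _ => ?_
          rw [← sum_filter, filter_mem_eq_inter, univ_inter]
      _ ≤ ∑ v ∈ A, (1 + t v) * (1 / 2 : ℝ) ^ D v := by
          refine sum_le_sum fun v _ => ?_
          have hc : ((out v).card : ℝ) ≤ 2 * (1 + t v) := by
            have h1 := ht v
            rw [Nat.card_eq_fintype_card, Fintype.card_subtype] at h1
            exact h1
          rw [sum_congr rfl fun x hx => by rw [(mem_filter.1 hx).2.2], sum_const, nsmul_eq_mul,
            pow_succ]
          nlinarith [hw v]
  -- `B` weighs at most `A` plus the correction, and it contains `A` apart from `u`, whose weight is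
  -- 1. Subtraction leaves the 1.
  have hsd : ∑ x ∈ B \ A.erase u, (1 / 2 : ℝ) ^ D x ≤ 1 + ∑ x, t x * (1 / 2 : ℝ) ^ D x := by
    have h1 := sum_sdiff (f := fun x => (1 / 2 : ℝ) ^ D x) hAB
    have h2 := add_sum_erase A (fun x => (1 / 2 : ℝ) ^ D x) huA
    simp only [hu, pow_zero] at h2
    have h3 : ∑ v ∈ A, (1 + t v) * (1 / 2 : ℝ) ^ D v =
        ∑ v ∈ A, (1 / 2 : ℝ) ^ D v + ∑ v ∈ A, t v * (1 / 2 : ℝ) ^ D v := by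
      rw [← sum_add_distrib]
      exact sum_congr rfl fun v _ => by ring
    have h4 : ∑ v ∈ A, t v * (1 / 2 : ℝ) ^ D v ≤ ∑ v, t v * (1 / 2 : ℝ) ^ D v :=
      sum_le_sum_of_subset_of_nonneg (subset_univ _) fun v _ _ => mul_nonneg (ht0 v) (hw v)
    linarith
  calc ∑ x ∈ X, distWeight H u (ρ x)
      ≤ ∑ x ∈ X, ((1 / 2 : ℝ) ^ D x + if x ∈ B \ A.erase u then (1 / 2 : ℝ) ^ D x else 0) :=
        sum_le_sum hval
    _ ≤ ∑ x, ((1 / 2 : ℝ) ^ D x + if x ∈ B \ A.erase u then (1 / 2 : ℝ) ^ D x else 0) := by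
        refine sum_le_sum_of_subset_of_nonneg (subset_univ _) fun x _ _ => ?_
        have := hw x
        split_ifs <;> linarith
    _ = ∑ x, (1 / 2 : ℝ) ^ D x + ∑ x ∈ B \ A.erase u, (1 / 2 : ℝ) ^ D x := by
        rw [sum_add_distrib, ← sum_filter, filter_mem_eq_inter, univ_inter]
    _ ≤ _ := by linarith

end General

/-! ### Geometric sums and outward neighbours in the grid -/

section Grid

theorem sum_range_half_pow_dist (a n : ℕ) :
    ∑ i ∈ range n, (1 / 2 : ℝ) ^ Nat.dist i a ≤ 3 := by
  have h1 : ∀ k ≤ a, ∑ i ∈ range k, (1 / 2 : ℝ) ^ Nat.dist i a ≤ (1 / 2 : ℝ) ^ (a - k) := by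
    intro k hk
    induction k with
    | zero => simp
    | succ k ih =>
      have h2 := ih (by omega)
      rw [sum_range_succ, show Nat.dist k a = (a - (k + 1)) + 1 by simp only [Nat.dist]; omega]
      rw [show a - k = (a - (k + 1)) + 1 by omega] at h2
      rw [pow_succ] at *
      linarith
  have h2 : ∀ k, ∑ i ∈ range (a + k), (1 / 2 : ℝ) ^ Nat.dist i a ≤ 3 - 2 * (1 / 2 : ℝ) ^ k := by
    intro k
    induction k with
    | zero =>
      have := h1 a le_rfl
      simp only [add_zero, Nat.sub_self, pow_zero] at *
      linarith
    | succ k ih =>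
      rw [← add_assoc, sum_range_succ,
        show Nat.dist (a + k) a = k by simp only [Nat.dist]; omega, pow_succ]
      linarith
  rcases le_total n a with h | h
  · have h3 := h1 n h
    have h4 : (1 / 2 : ℝ) ^ (a - n) ≤ 1 := pow_le_one₀ (by norm_num) (by norm_num)
    linarith
  · have h3 := h2 (n - a)
    rw [show a + (n - a) = n by omega] at h3
    have h4 : (0 : ℝ) ≤ (1 / 2 : ℝ) ^ (n - a) := by positivity
    linarith

theorem sum_fin_half_pow_dist (n a : ℕ) :
    ∑ i : Fin n, (1 / 2 : ℝ) ^ Nat.dist i a ≤ 3 := by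
  rw [Fin.sum_univ_eq_sum_range fun i => (1 / 2 : ℝ) ^ Nat.dist i a]
  exact sum_range_half_pow_dist a n

theorem dist_le_of_pathGraph_adj {n : ℕ} {i j : Fin n} (h : (SimpleGraph.pathGraph n).Adj i j)
    (a : ℕ) : Nat.dist j a ≤ Nat.dist i a + 1 := by
  rw [SimpleGraph.pathGraph_adj] at h
  simp only [Nat.dist]
  omega

open Classical in
theorem card_pathGraph_outward_le {n : ℕ} (i : Fin n) (a : Fin n) :
    #{j : Fin n | (SimpleGraph.pathGraph n).Adj i j ∧ Nat.dist j a = Nat.dist i a + 1} ≤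
      1 + if i = a then 1 else 0 := by
  simp only [SimpleGraph.pathGraph_adj]
  split_ifs with h
  · have hl : #{j : Fin n | (i : ℕ) + 1 = j} ≤ 1 := by
      refine card_le_one.2 fun x hx y hy => ?_
      simp only [mem_filter, mem_univ, true_and] at hx hy
      exact Fin.ext (by omega)
    have hr : #{j : Fin n | (j : ℕ) + 1 = i} ≤ 1 := by
      refine card_le_one.2 fun x hx y hy => ?_
      simp only [mem_filter, mem_univ, true_and] at hx hy
      exact Fin.ext (by omega)
    refine le_trans (card_le_card ?_) ((card_union_le _ _).trans (add_le_add hl hr))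
    intro j hj
    simp only [mem_filter, mem_univ, true_and, mem_union] at hj ⊢
    exact hj.1
  · refine card_le_one.2 fun x hx y hy => ?_
    have hx' := (mem_filter.1 hx).2
    have hy' := (mem_filter.1 hy).2
    simp only [Nat.dist] at hx' hy'
    have : (i : ℕ) ≠ a := fun h' => h (Fin.ext h')
    exact Fin.ext (by omega)

open Classical in
theorem card_grid_outward_le {n m : ℕ} (u v : Fin n × Fin m) :
    (Nat.card {x : Fin n × Fin m //
      (SimpleGraph.boxProd (SimpleGraph.pathGraph n) (SimpleGraph.pathGraph m)).Adj v x ∧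
      Nat.dist x.1 u.1 + Nat.dist x.2 u.2 = Nat.dist v.1 u.1 + Nat.dist v.2 u.2 + 1} : ℝ) ≤
      2 * (1 + ((if v.1 = u.1 then 1 / 2 else 0) + if v.2 = u.2 then 1 / 2 else 0)) := by
  have h1 := card_pathGraph_outward_le v.1 u.1
  have h2 := card_pathGraph_outward_le v.2 u.2
  rw [Nat.card_eq_fintype_card, Fintype.card_subtype]
  set S₁ : Finset (Fin n) :=
    {j : Fin n | (SimpleGraph.pathGraph n).Adj v.1 j ∧ Nat.dist j u.1 = Nat.dist v.1 u.1 + 1}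
  set S₂ : Finset (Fin m) :=
    {j : Fin m | (SimpleGraph.pathGraph m).Adj v.2 j ∧ Nat.dist j u.2 = Nat.dist v.2 u.2 + 1}
  have hle : #{x : Fin n × Fin m |
      (SimpleGraph.boxProd (SimpleGraph.pathGraph n) (SimpleGraph.pathGraph m)).Adj v x ∧
      Nat.dist x.1 u.1 + Nat.dist x.2 u.2 = Nat.dist v.1 u.1 + Nat.dist v.2 u.2 + 1} ≤
      #S₁ + #S₂ := by
    have hsub : ({x : Fin n × Fin m |
      (SimpleGraph.boxProd (SimpleGraph.pathGraph n) (SimpleGraph.pathGraph m)).Adj v x ∧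
      Nat.dist x.1 u.1 + Nat.dist x.2 u.2 = Nat.dist v.1 u.1 + Nat.dist v.2 u.2 + 1} : Finset _) ⊆
      S₁.image (fun j => (j, v.2)) ∪ S₂.image (fun j => (v.1, j)) := by
      rintro ⟨x₁, x₂⟩ hx
      simp only [mem_filter, mem_univ, true_and, SimpleGraph.boxProd_adj] at hx
      rw [mem_union, mem_image, mem_image]
      obtain ⟨⟨h, he⟩ | ⟨h, he⟩, hd⟩ := hx
      · refine Or.inl ⟨x₁, mem_filter.2 ⟨mem_univ _, h, ?_⟩, by rw [he]⟩
        rw [he] at hd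
        omega
      · refine Or.inr ⟨x₂, mem_filter.2 ⟨mem_univ _, h, ?_⟩, by rw [he]⟩
        rw [he] at hd
        omega
    exact (card_le_card hsub).trans
      ((card_union_le _ _).trans (add_le_add card_image_le card_image_le))
  have h3 : (#S₁ : ℝ) ≤ 1 + if v.1 = u.1 then 1 else 0 := by exact_mod_cast h1
  have h4 : (#S₂ : ℝ) ≤ 1 + if v.2 = u.2 then 1 else 0 := by exact_mod_cast h2
  refine (Nat.cast_le.2 hle).trans ?_
  push_cast
  split_ifs at * <;> linarith

theorem sum_grid_half_pow_dist_le {n m : ℕ} (a b : ℕ) :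
    ∑ x : Fin n × Fin m, (1 / 2 : ℝ) ^ (Nat.dist x.1 a + Nat.dist x.2 b) ≤ 9 := by
  simp_rw [pow_add]
  rw [Fintype.sum_prod_type]
  simp only
  rw [← sum_mul_sum]
  have h1 := sum_fin_half_pow_dist n a
  have h2 := sum_fin_half_pow_dist m b
  have h3 : 0 ≤ ∑ i : Fin m, (1 / 2 : ℝ) ^ Nat.dist i b := sum_nonneg fun _ _ => by positivity
  nlinarith

/-- Each axis contributes half of a one-dimensional sum that is at most 3. -/
theorem sum_grid_axes_le {n m : ℕ} (u : Fin n × Fin m) :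
    ∑ x : Fin n × Fin m, ((if x.1 = u.1 then 1 / 2 else 0) + if x.2 = u.2 then 1 / 2 else 0) *
      (1 / 2 : ℝ) ^ (Nat.dist x.1 u.1 + Nat.dist x.2 u.2) ≤ 3 := by
  have h1 := sum_fin_half_pow_dist n u.1
  have h2 := sum_fin_half_pow_dist m u.2
  simp_rw [add_mul, ite_mul, zero_mul]
  rw [sum_add_distrib, Fintype.sum_prod_type, Fintype.sum_prod_type_right]
  simp only [sum_ite_irrel, sum_const_zero, sum_ite_eq', mem_univ, if_true, Nat.dist_self, zero_add,
    add_zero, ← mul_sum]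
  linarith

theorem two_mul_card_grid_le {n m : ℕ} {P : Distribution (Fin n × Fin m)}
    (hP : IsSolvable
      (SimpleGraph.boxProd (SimpleGraph.pathGraph n) (SimpleGraph.pathGraph m)) P) :
    2 * ((n : ℝ) * m) ≤ 13 * (P.size : ℝ) := by
  have h := two_mul_card_le_of_isSolvable hP (C := 13) (by norm_num) ?_
  · simpa using h
  · intro T X ρ hρ u hu
    refine (sum_distWeight_representatives_le hρ
      (D := fun x => Nat.dist x.1 u.1 + Nat.dist x.2 u.2) ?_ hu (by simp [Nat.dist_self])
      -- A vertex has at most two outward neighbours off the axes, three on one axis and four at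
      -- `u`. Each axis adds one, hence `1 / 2` in `2 * (1 + t v)`.
      (fun v => (if v.1 = u.1 then 1 / 2 else 0) + if v.2 = u.2 then 1 / 2 else 0) ?_ ?_).trans ?_
    · rintro ⟨a₁, a₂⟩ ⟨b₁, b₂⟩ hab
      rw [SimpleGraph.boxProd_adj] at hab
      obtain ⟨h, he⟩ | ⟨h, he⟩ := hab
      · have := dist_le_of_pathGraph_adj h u.1
        simp only at *
        subst he
        omega
      · have := dist_le_of_pathGraph_adj h u.2
        simp only at *
        subst he
        omega
    · intro v
      positivity
    · intro v
      exact card_grid_outward_le u v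
    · have h1 := sum_grid_half_pow_dist_le (n := n) (m := m) u.1 u.2
      have h2 := sum_grid_axes_le u
      linarith

end Grid

end Pebbling

theorem mainTheorem3 (n m : ℕ) (hn : 5 ≤ n) (hm : 5 ≤ m) :
    (2 / 13 : ℝ) * (n : ℝ) * (m : ℝ) ≤
      (Pebbling.optimalPebblingNumber
        (SimpleGraph.boxProd (SimpleGraph.pathGraph n) (SimpleGraph.pathGraph m)) : ℝ) := by
  obtain ⟨P, hP, hsize⟩ := (Pebbling.isLeast_optimalPebblingNumber
    (SimpleGraph.boxProd (SimpleGraph.pathGraph n) (SimpleGraph.pathGraph m))).1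
  have h := Pebbling.two_mul_card_grid_le hP
  rw [← hsize]
  linarith
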